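/- Let $n,m\ge 1$ be integers. They are called exponentially coprime if they have the same prime factors and, writing $n=\prod_i p_i^{a_i}$ and $m=\prod_i p_i^{b_i}$ with distinct primes $p_i$ and $a_i,b_i\ge 1$, one has $\gcd(a_i,b_i)=1$ for every $i$. Let $\kappa(n)$ denote the squarefree kernel of $n$, that is, the product of the distinct primes dividing $n$. Let $r\ge 1$ be a fixed integer and let $p_1,\dots,p_r$ be fixed distinct primes. For real $x\ge 3$ let $P^{(e)}(p_1,\dots,p_r;x)$ denote the number of ordered pairs $\langle n,m\rangle$ of exponentially coprime integers such that $n,m\le x$ and $\kappa(n)=\kappa(m)=p_1\cdots p_r$. Then, for $x\ge 3$, $$P^{(e)}(p_1,\dots,p_r;x)=\frac{1}{(r!)^2\,\zeta(2)^r}\left(\prod_{i=1}^r\frac{1}{(\log p_i)^2}\right)(\log x)^{2r}+O\!\left((\log x)^{2r-1}\log\log x\right),$$ where the implied constant may depend on $r$ and $p_1,\dots,p_r$ but not on $x$. -/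

import Mathlib

/-- Positive integers `n`, `m` are exponentially coprime if they have the same prime factors and,
for each of these primes, its exponents in `n` and in `m` are coprime. (So `1` and `1` are
exponentially coprime, and `1` and `m > 1` are not.) -/
def ExpCoprime (n m : ℕ) : Prop :=
  n ≠ 0 ∧ m ≠ 0 ∧ n.primeFactors = m.primeFactors ∧
    ∀ p ∈ n.primeFactors, Nat.Coprime (n.factorization p) (m.factorization p)

/-- The squarefree kernel of `n`: the product of the distinct primes dividing `n`. -/
def sqfreeKernel (n : ℕ) : ℕ := ∏ p ∈ n.primeFactors, p

/-- The set of ordered pairs `(n, m)` of exponentially coprime positive integers `n, m ≤ x`,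
both having squarefree kernel `∏ i, p i`. -/
def expCoprimePairs {r : ℕ} (p : Fin r → ℕ) (x : ℝ) : Set (ℕ × ℕ) :=
  {q | ExpCoprime q.1 q.2 ∧ sqfreeKernel q.1 = ∏ i, p i ∧ sqfreeKernel q.2 = ∏ i, p i ∧
    (q.1 : ℝ) ≤ x ∧ (q.2 : ℝ) ≤ x}

/-- The set that is counted is finite, so that its `Set.ncard` is its true cardinality. -/
theorem expCoprimePairs_finite {r : ℕ} (p : Fin r → ℕ) (x : ℝ) :
    (expCoprimePairs p x).Finite := by
  refine ((Set.finite_Iic ⌊x⌋₊).prod (Set.finite_Iic ⌊x⌋₊)).subset ?_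
  rintro ⟨n, m⟩ ⟨-, -, -, h1, h2⟩
  exact ⟨Nat.le_floor h1, Nat.le_floor h2⟩

/-- The number of ordered pairs `(n, m)` of exponentially coprime integers `n, m ≤ x`, both having
squarefree kernel `∏ i, p i`. -/
noncomputable def expCoprimeCount {r : ℕ} (p : Fin r → ℕ) (x : ℝ) : ℕ :=
  (expCoprimePairs p x).ncard

/-!
Taking exponents in the prime factorizations turns the counted pairs into pairs `(a, b)` of vectors
of positive integers with `a i`, `b i` coprime for every `i` and with `∑ i, a i * w i ≤ log x`,
`∑ i, b i * w i ≤ log x`, where `w i = log (p i)` (`expCoprimeCount_eq_card`).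

Let `#(w; s, t)` be the number of such pairs with bounds `s` and `t` in place of `log x`. Splitting
off the first coordinate gives the recursion
`#(w; s, t) = ∑ #(tail w; s - a * w 0, t - b * w 0)` over coprime `a ≤ s / w 0`, `b ≤ t / w 0`
(`card_coprimeExponents_succ`), so the asymptotic formula can be proved by induction on `r`,
uniformly in `0 ≤ s, t ≤ M`, with an error of relative size `(1 + log M) / M`
(`abs_card_coprimeExponents_sub_le`). An error of this relative size survives the recursion because
there are at most `(M / w 0) ^ 2` pairs `(a, b)`.

What remains is the main term, the sum of `(s - a * w) ^ r * (t - b * w) ^ r` over coprime `a`, `b`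
(`abs_sum_coprime_pow_sub_le`). The Möbius function detects coprimality, and the sum becomes
`∑ μ(d) * G(s, d * w) * G(t, d * w)` with `G(s, v) = ∑ (s - k * v) ^ r` over `1 ≤ k ≤ s / v`.
A telescoping comparison gives `G(s, v) = s ^ (r + 1) / ((r + 1) * v) + O(s ^ r)`, so the leading
terms add up to a multiple of a partial sum of `∑ μ(d) / d ^ 2 = 1 / ζ(2)`, and the errors to
`M ^ (2 * r + 1)` times a harmonic sum over `d ≤ M / w + 1`. That harmonic sum is the source of the
factor `log log x`.
-/

open Finset

/-! ### Sums of powers along an arithmetic progression -/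

theorem pow_succ_sub_pow_succ_bounds {x y : ℝ} (hy : 0 ≤ y) (hyx : y ≤ x) (r : ℕ) :
    (r + 1) * y ^ r * (x - y) ≤ x ^ (r + 1) - y ^ (r + 1) ∧
      x ^ (r + 1) - y ^ (r + 1) ≤ (r + 1) * x ^ r * (x - y) := by
  have hx : 0 ≤ x := hy.trans hyx
  induction r with
  | zero => simp
  | succ r ih =>
    obtain ⟨h1, h2⟩ := ih
    have hpow : y ^ (r + 1) ≤ x ^ (r + 1) := pow_le_pow_left₀ hy hyx _
    have hm := mul_nonneg (sub_nonneg.2 hpow) (sub_nonneg.2 hyx)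
    have e : x ^ (r + 1 + 1) - y ^ (r + 1 + 1) =
      x * (x ^ (r + 1) - y ^ (r + 1)) + y ^ (r + 1) * (x - y) := by ring
    have e' : x ^ (r + 1 + 1) - y ^ (r + 1 + 1) =
      y * (x ^ (r + 1) - y ^ (r + 1)) + x ^ (r + 1) * (x - y) := by ring
    push_cast
    constructor
    · rw [e']
      have := mul_le_mul_of_nonneg_left h1 hy
      have e1 : y * ((r + 1) * y ^ r * (x - y)) = (r + 1) * y ^ (r + 1) * (x - y) := by ring
      nlinarith
    · rw [e]
      have := mul_le_mul_of_nonneg_left h2 hx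
      have e1 : x * ((r + 1) * x ^ r * (x - y)) = (r + 1) * x ^ (r + 1) * (x - y) := by ring
      nlinarith

/-- Comparison of the sum of `(s - k * v) ^ r` with the integral of `u ↦ u ^ r` from `s - K * v` to
`s`: the integral lies between the right and the left Riemann sum of step `v`. -/
theorem sum_pow_sub_mul_bounds {s v : ℝ} (hv : 0 < v) (r K : ℕ) (hK : K * v ≤ s) :
    (r + 1) * v * ∑ k ∈ Icc 1 K, (s - k * v) ^ r ≤ s ^ (r + 1) - (s - K * v) ^ (r + 1) ∧
      s ^ (r + 1) - (s - K * v) ^ (r + 1) ≤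
        (r + 1) * v * (∑ k ∈ Icc 1 K, (s - k * v) ^ r + s ^ r - (s - K * v) ^ r) := by
  induction K with
  | zero => simp
  | succ K ih =>
    push_cast at hK ⊢
    obtain ⟨h1, h2⟩ := ih (by nlinarith)
    obtain ⟨h3, h4⟩ := pow_succ_sub_pow_succ_bounds (x := s - K * v) (y := s - (K + 1) * v)
      (by linarith) (by nlinarith) r
    rw [Finset.sum_Icc_succ_top (by omega)]
    push_cast
    have e : s - K * v - (s - (K + 1) * v) = v := by ring
    rw [e] at h3 h4
    constructor <;> nlinarith

/-- The function `G(s, v) = ∑ (s - k * v) ^ r` over `1 ≤ k ≤ s / v` equals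
`s ^ (r + 1) / ((r + 1) * v)` up to an error between `-s ^ r` and `0`. -/
theorem sum_pow_sub_mul_floor_bounds {s v : ℝ} (hs : 0 ≤ s) (hv : 0 < v) (r : ℕ) :
    0 ≤ ∑ k ∈ Icc 1 ⌊s / v⌋₊, (s - k * v) ^ r ∧
    ∑ k ∈ Icc 1 ⌊s / v⌋₊, (s - k * v) ^ r ≤ s ^ (r + 1) / ((r + 1) * v) ∧
      s ^ (r + 1) / ((r + 1) * v) - s ^ r ≤ ∑ k ∈ Icc 1 ⌊s / v⌋₊, (s - k * v) ^ r := by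
  have hK : (⌊s / v⌋₊ : ℝ) * v ≤ s := (le_div_iff₀ hv).1 (Nat.floor_le (by positivity))
  have hK' : s < (⌊s / v⌋₊ + 1 : ℝ) * v := (div_lt_iff₀ hv).1 (Nat.lt_floor_add_one _)
  obtain ⟨h1, h2⟩ := sum_pow_sub_mul_bounds hv r _ hK
  set y := s - ⌊s / v⌋₊ * v with hy
  have hy0 : 0 ≤ y := by linarith
  have hyv : y ≤ v := by linarith
  have hpos : 0 < (r + 1) * v := by positivity
  refine ⟨sum_nonneg fun k hk => pow_nonneg (sub_nonneg.2 ?_) _, ?_, ?_⟩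
  · have : (k : ℝ) ≤ ⌊s / v⌋₊ := by exact_mod_cast (mem_Icc.1 hk).2
    nlinarith
  · rw [le_div_iff₀ hpos]
    have : 0 ≤ y ^ (r + 1) := by positivity
    linarith
  -- The term `y ^ (r + 1)` is absorbed by `(r + 1) * v * y ^ r`, because `y ≤ v`.
  · rw [sub_le_iff_le_add, div_le_iff₀ hpos]
    have h3 : y ^ (r + 1) ≤ (r + 1) * v * y ^ r := by
      rw [pow_succ, mul_comm]
      apply mul_le_mul_of_nonneg_right _ (by positivity)
      have : 0 ≤ (r : ℝ) * v := by positivity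
      linarith
    linarith

/-! ### Möbius sums -/

theorem hasSum_moebius_div_sq :
    HasSum (fun d : ℕ => (ArithmeticFunction.moebius d : ℝ) / (d : ℝ) ^ 2)
      ((riemannZeta 2).re)⁻¹ := by
  have h1 : 1 < (2 : ℂ).re := by norm_num
  have hs := (ArithmeticFunction.LSeriesSummable_moebius_iff.2 h1).hasSum
  have hv := ArithmeticFunction.LSeries_zeta_mul_Lseries_moebius h1
  rw [ArithmeticFunction.LSeries_zeta_eq_riemannZeta h1] at hv
  have hz : riemannZeta 2 = ((riemannZeta 2).re : ℂ) := by
    rw [riemannZeta_two]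
    norm_cast
  rw [hz] at hv
  have hL : LSeries (fun n => ((ArithmeticFunction.moebius n : ℤ) : ℂ)) 2
      = (((riemannZeta 2).re)⁻¹ : ℝ) := by
    rw [Complex.ofReal_inv]
    exact eq_inv_of_mul_eq_one_right hv
  rw [← Complex.hasSum_ofReal]
  rw [LSeries] at hL
  rw [hL] at hs
  convert hs using 2 with d
  rcases eq_or_ne d 0 with rfl | hd
  · simp
  · simp [LSeries.term_of_ne_zero hd]

theorem abs_sum_moebius_div_sq_sub_le {D : ℕ} (hD : 1 ≤ D) :
    |∑ d ∈ Icc 1 D, (ArithmeticFunction.moebius d : ℝ) / (d : ℝ) ^ 2 - ((riemannZeta 2).re)⁻¹|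
      ≤ 1 / D := by
  have ht := hasSum_moebius_div_sq.tendsto_sum_nat
  have ht' := ((ht.const_sub
    (∑ d ∈ Icc 1 D, (ArithmeticFunction.moebius d : ℝ) / (d : ℝ) ^ 2))).abs
  refine le_of_tendsto ht' ?_
  filter_upwards [Filter.eventually_ge_atTop (D + 1)] with n hn
  have e : ∑ d ∈ range n, (ArithmeticFunction.moebius d : ℝ) / (d : ℝ) ^ 2 =
      ∑ d ∈ Icc 1 D, (ArithmeticFunction.moebius d : ℝ) / (d : ℝ) ^ 2 +
      ∑ d ∈ Ioc D (n - 1), (ArithmeticFunction.moebius d : ℝ) / (d : ℝ) ^ 2 := by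
    rw [← sum_union]
    · symm
      apply sum_subset
      · intro d hd
        simp only [mem_union, mem_Icc, mem_Ioc, mem_range] at hd ⊢
        omega
      · intro d hd hd'
        simp only [mem_union, mem_Icc, mem_Ioc, mem_range] at hd hd'
        have : d = 0 := by omega
        simp [this]
    · rw [disjoint_left]
      intro d h1 h2
      simp only [mem_Icc, mem_Ioc] at h1 h2
      omega
  rw [e, sub_add_cancel_left, abs_neg]
  refine (abs_sum_le_sum_abs _ _).trans ?_
  calc _ ≤ ∑ d ∈ Ioc D (n - 1), ((d : ℝ) ^ 2)⁻¹ := by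
        refine sum_le_sum fun d _ => ?_
        rw [abs_div, abs_of_nonneg (by positivity : (0 : ℝ) ≤ (d : ℝ) ^ 2), div_eq_mul_inv]
        refine mul_le_of_le_one_left (by positivity) ?_
        exact_mod_cast ArithmeticFunction.abs_moebius_le_one
    _ ≤ (D : ℝ)⁻¹ - ((n - 1 : ℕ) : ℝ)⁻¹ := sum_Ioc_inv_sq_le_sub (by omega) (by omega)
    _ ≤ 1 / D := by
        rw [one_div]
        have : (0 : ℝ) ≤ ((n - 1 : ℕ) : ℝ)⁻¹ := by positivity
        linarith

theorem sum_Icc_dvd_eq (f : ℕ → ℝ) (A : ℕ) {d : ℕ} (hd : 0 < d) :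
    ∑ a ∈ Icc 1 A, (if d ∣ a then f a else 0) = ∑ k ∈ Icc 1 (A / d), f (k * d) := by
  rw [← sum_filter]
  symm
  refine sum_bij (fun k _ => k * d) ?_ ?_ ?_ ?_
  · intro k hk
    rw [mem_Icc, Nat.le_div_iff_mul_le hd] at hk
    simp only [mem_filter, mem_Icc, dvd_mul_left, and_true]
    exact ⟨Nat.mul_pos hk.1 hd, hk.2⟩
  · intro a _ b _ h
    exact Nat.eq_of_mul_eq_mul_right hd h
  · intro a ha
    simp only [mem_filter, mem_Icc] at ha
    obtain ⟨⟨h1, h2⟩, k, rfl⟩ := ha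
    refine ⟨k, ?_, mul_comm _ _⟩
    rw [mem_Icc, Nat.le_div_iff_mul_le hd, mul_comm]
    exact ⟨Nat.pos_of_ne_zero fun h => by simp [h] at h1, h2⟩
  · simp

/-- Möbius inversion over pairs: since `∑ μ(d)` over `d ∣ gcd a b` is the indicator of
`gcd a b = 1`, a sum of products over coprime pairs decouples. Any `D ≥ A` may bound the range
of `d`, because `A / d = 0` for `d > A`. -/
theorem sum_coprime_eq_sum_moebius (f g : ℕ → ℝ) (A B : ℕ) {D : ℕ} (hD : A ≤ D) :
    ∑ a ∈ Icc 1 A, ∑ b ∈ Icc 1 B, (if a.Coprime b then f a * g b else 0) =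
      ∑ d ∈ Icc 1 D, (ArithmeticFunction.moebius d : ℝ) *
        ((∑ k ∈ Icc 1 (A / d), f (k * d)) * ∑ k ∈ Icc 1 (B / d), g (k * d)) := by
  have key : ∀ a ∈ Icc 1 A, ∀ b ∈ Icc 1 B, (if a.Coprime b then f a * g b else 0) =
      ∑ d ∈ Icc 1 D, (ArithmeticFunction.moebius d : ℝ) *
        ((if d ∣ a then f a else 0) * (if d ∣ b then g b else 0)) := by
    intro a ha b hb
    rw [mem_Icc] at ha hb
    have h0 : a.gcd b ≠ 0 := by
      rw [Ne, Nat.gcd_eq_zero_iff]; omega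
    have h1 : ∑ d ∈ (a.gcd b).divisors, (ArithmeticFunction.moebius d : ℝ) =
        if a.gcd b = 1 then 1 else 0 := by
      have h := ArithmeticFunction.coe_mul_zeta_apply
        (f := ArithmeticFunction.moebius) (x := a.gcd b)
      rw [ArithmeticFunction.moebius_mul_coe_zeta, ArithmeticFunction.one_apply] at h
      exact_mod_cast h.symm
    have h2 : (a.gcd b).divisors = (Icc 1 D).filter (fun d => d ∣ a ∧ d ∣ b) := by
      ext d
      simp only [Nat.mem_divisors, mem_filter, mem_Icc, Nat.dvd_gcd_iff]
      constructor
      · rintro ⟨⟨h, h'⟩, -⟩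
        exact ⟨⟨Nat.pos_of_dvd_of_pos h ha.1, (Nat.le_of_dvd ha.1 h).trans (ha.2.trans hD)⟩, h, h'⟩
      · rintro ⟨-, h⟩
        exact ⟨h, h0⟩
    have h3 : (if a.Coprime b then f a * g b else 0) =
        (if a.gcd b = 1 then 1 else 0) * (f a * g b) := by
      by_cases h : a.gcd b = 1
      · rw [if_pos h, if_pos h, one_mul]
      · rw [if_neg h, if_neg h, zero_mul]
    rw [h3, ← h1, h2, sum_mul, sum_filter]
    refine sum_congr rfl fun d _ => ?_
    by_cases hda : d ∣ a <;> by_cases hdb : d ∣ b <;> simp [hda, hdb]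
  rw [sum_congr rfl fun a ha => sum_congr rfl (key a ha)]
  rw [sum_congr rfl fun a _ => sum_comm, sum_comm]
  refine sum_congr rfl fun d hd => ?_
  rw [mem_Icc] at hd
  rw [← sum_Icc_dvd_eq f A hd.1, ← sum_Icc_dvd_eq g B hd.1, sum_mul_sum, mul_sum]
  refine sum_congr rfl fun a _ => ?_
  rw [mul_sum]

/-- The sum of `(s - a * w) ^ r * (t - b * w) ^ r` over coprime `a`, `b` is `1 / ζ(2)` times the
value expected for the sum over all `a`, `b`, with an error that is uniform in
`0 ≤ s, t ≤ M`. -/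
theorem abs_sum_coprime_pow_sub_le {w : ℝ} (hw : 0 < w) (r : ℕ) :
    ∃ K : ℝ, 0 ≤ K ∧ ∀ M : ℝ, 1 ≤ M → ∀ s t : ℝ, 0 ≤ s → s ≤ M → 0 ≤ t → t ≤ M →
      |∑ a ∈ Icc 1 ⌊s / w⌋₊, ∑ b ∈ Icc 1 ⌊t / w⌋₊,
          (if a.Coprime b then (s - a * w) ^ r * (t - b * w) ^ r else 0) -
        s ^ (r + 1) * t ^ (r + 1) / ((r + 1) ^ 2 * w ^ 2) * ((riemannZeta 2).re)⁻¹| ≤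
      K * (M ^ (2 * r + 1) * (1 + Real.log M)) := by
  refine ⟨2 / w * (1 + Real.log (1 / w + 1)) + 1 / w, ?_, ?_⟩
  · have : 0 ≤ Real.log (1 / w + 1) := Real.log_nonneg (by
      have : 0 ≤ 1 / w := by positivity
      linarith)
    positivity
  intro M hM s t hs hsM ht htM
  have hM0 : 0 < M := by linarith
  have hlogM : 0 ≤ Real.log M := Real.log_nonneg hM
  -- This bound on `d` is the same for all `s` and `t`, and is large enough for `A = ⌊s / w⌋₊`.
  set D := ⌊M / w⌋₊ + 1 with hD
  have hDM : M / w ≤ (D : ℝ) := by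
    rw [hD]; push_cast; exact (Nat.lt_floor_add_one _).le
  have hDM' : (D : ℝ) ≤ M * (1 / w + 1) := by
    have : (⌊M / w⌋₊ : ℝ) ≤ M / w := Nat.floor_le (by positivity)
    rw [hD]; push_cast
    have e : M * (1 / w + 1) = M / w + M := by ring
    linarith
  have hD0 : (0 : ℝ) < D := by positivity
  have hAD : ⌊s / w⌋₊ ≤ D := (Nat.floor_le_floor (by gcongr)).trans (Nat.le_succ _)
  set c := Real.log (1 / w + 1) with hc
  have hc0 : 0 ≤ c := Real.log_nonneg (by
    have : 0 ≤ 1 / w := by positivity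
    linarith)
  have hlogD : 1 + Real.log D ≤ (1 + c) * (1 + Real.log M) := by
    have h1 : Real.log D ≤ Real.log M + c := by
      rw [hc, ← Real.log_mul (by positivity) (by positivity)]
      exact Real.log_le_log hD0 hDM'
    nlinarith [mul_nonneg hc0 hlogM]
  rw [sum_coprime_eq_sum_moebius (fun a => (s - a * w) ^ r) (fun b => (t - b * w) ^ r) _ _ hAD]
  set P := s ^ (r + 1) * t ^ (r + 1) / ((r + 1) ^ 2 * w ^ 2) with hP
  have hr1 : (1 : ℝ) ≤ r + 1 := by
    have : (0 : ℝ) ≤ r := by positivity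
    linarith
  have hP0 : 0 ≤ P := by positivity
  have hP1 : P ≤ M ^ (2 * r + 2) / w ^ 2 := by
    rw [hP]
    have e : M ^ (2 * r + 2) = M ^ (r + 1) * M ^ (r + 1) := by ring
    rw [e]
    gcongr
    have : (1 : ℝ) ≤ (r + 1) ^ 2 := one_le_pow₀ hr1
    nlinarith [sq_nonneg w]
  -- The terms with `d > s / w` or `d > t / w` need no separate treatment: there `G` vanishes, and
  -- its expected value is at most the allowed error.
  have hterm : ∀ d ∈ Icc 1 D,
      |(ArithmeticFunction.moebius d : ℝ) *
          ((∑ k ∈ Icc 1 (⌊s / w⌋₊ / d), (s - ((k * d : ℕ) : ℝ) * w) ^ r) *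
            ∑ k ∈ Icc 1 (⌊t / w⌋₊ / d), (t - ((k * d : ℕ) : ℝ) * w) ^ r) -
        (ArithmeticFunction.moebius d : ℝ) / (d : ℝ) ^ 2 * P| ≤
      2 * M ^ (2 * r + 1) / w * (d : ℝ)⁻¹ := by
    intro d hd
    have hd0 : (0 : ℝ) < d := by exact_mod_cast (mem_Icc.1 hd).1
    have hv : 0 < d * w := by positivity
    have hG : ∀ u : ℝ, ∑ k ∈ Icc 1 (⌊u / w⌋₊ / d), (u - ((k * d : ℕ) : ℝ) * w) ^ r =
        ∑ k ∈ Icc 1 ⌊u / (d * w)⌋₊, (u - k * (d * w)) ^ r := by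
      intro u
      rw [← Nat.floor_div_natCast, div_div, mul_comm w]
      refine sum_congr rfl fun k _ => ?_
      push_cast
      ring
    rw [hG, hG]
    obtain ⟨a0, a1, a2⟩ := sum_pow_sub_mul_floor_bounds hs hv r
    obtain ⟨b0, b1, b2⟩ := sum_pow_sub_mul_floor_bounds ht hv r
    set G := ∑ k ∈ Icc 1 ⌊s / (d * w)⌋₊, (s - k * (d * w)) ^ r
    set H := ∑ k ∈ Icc 1 ⌊t / (d * w)⌋₊, (t - k * (d * w)) ^ r
    set g := s ^ (r + 1) / ((r + 1) * (d * w)) with hg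
    set h := t ^ (r + 1) / ((r + 1) * (d * w)) with hh
    have hgh : P / (d : ℝ) ^ 2 = g * h := by
      rw [hP, hg, hh]
      field_simp
    have hgM : ∀ u : ℝ, 0 ≤ u → u ≤ M →
        u ^ (r + 1) / ((r + 1) * (d * w)) ≤ M ^ (r + 1) / (d * w) := by
      intro u hu huM
      refine div_le_div₀ (by positivity) (by gcongr) hv ?_
      exact le_mul_of_one_le_left hv.le hr1
    have hg1 := hgM s hs hsM
    have hh1 := hgM t ht htM
    have hsr : s ^ r ≤ M ^ r := by gcongr
    have htr : t ^ r ≤ M ^ r := by gcongr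
    have hsr0 : 0 ≤ s ^ r := by positivity
    have htr0 : 0 ≤ t ^ r := by positivity
    have hX0 : 0 ≤ M ^ (r + 1) / (d * w) := by positivity
    have e1 : (ArithmeticFunction.moebius d : ℝ) * (G * H) -
        (ArithmeticFunction.moebius d : ℝ) / (d : ℝ) ^ 2 * P =
        (ArithmeticFunction.moebius d : ℝ) * (G * H - g * h) := by
      rw [← hgh]; ring
    have hmu : |(ArithmeticFunction.moebius d : ℝ)| ≤ 1 := by
      exact_mod_cast ArithmeticFunction.abs_moebius_le_one
    rw [e1, abs_mul]
    refine (mul_le_of_le_one_left (abs_nonneg _) hmu).trans ?_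
    have e2 : g * h - G * H = g * (h - H) + (g - G) * H := by ring
    have h3 : 0 ≤ g * h - G * H := by
      rw [e2]
      exact add_nonneg (mul_nonneg (a0.trans a1) (by linarith)) (mul_nonneg (by linarith) b0)
    have h4 : g * (h - H) ≤ M ^ (r + 1) / (d * w) * M ^ r :=
      mul_le_mul hg1 (by linarith) (by linarith) hX0
    have h5 : (g - G) * H ≤ M ^ r * (M ^ (r + 1) / (d * w)) :=
      mul_le_mul (by linarith) (by linarith) b0 (by positivity)
    rw [abs_sub_comm, abs_of_nonneg h3, e2]
    calc _ ≤ M ^ (r + 1) / (d * w) * M ^ r + M ^ r * (M ^ (r + 1) / (d * w)) := add_le_add h4 h5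
      _ = 2 * M ^ (2 * r + 1) / w * (d : ℝ)⁻¹ := by
        field_simp
        ring
  have hharm : ∑ d ∈ Icc 1 D, (d : ℝ)⁻¹ ≤ 1 + Real.log D := by
    have h := harmonic_le_one_add_log D
    rw [harmonic_eq_sum_Icc] at h
    push_cast at h
    exact h
  have hfirst := (abs_sum_le_sum_abs _ _).trans (sum_le_sum hterm)
  rw [← mul_sum, sum_sub_distrib, ← sum_mul] at hfirst
  have hsecond := mul_le_mul_of_nonneg_left
    (abs_sum_moebius_div_sq_sub_le (D := D) (by omega)) hP0
  set S1 := ∑ d ∈ Icc 1 D, (ArithmeticFunction.moebius d : ℝ) / (d : ℝ) ^ 2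
  set S0 := ∑ d ∈ Icc 1 D, (ArithmeticFunction.moebius d : ℝ) *
          ((∑ k ∈ Icc 1 (⌊s / w⌋₊ / d), (s - ((k * d : ℕ) : ℝ) * w) ^ r) *
            ∑ k ∈ Icc 1 (⌊t / w⌋₊ / d), (t - ((k * d : ℕ) : ℝ) * w) ^ r)
  have hfirst' : |S0 - S1 * P| ≤ 2 * M ^ (2 * r + 1) / w * ((1 + c) * (1 + Real.log M)) :=
    hfirst.trans (mul_le_mul_of_nonneg_left (hharm.trans hlogD) (by positivity))
  have hsecond' : |S1 * P - P * ((riemannZeta 2).re)⁻¹| ≤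
      M ^ (2 * r + 1) / w * (1 + Real.log M) := by
    have e : S1 * P - P * ((riemannZeta 2).re)⁻¹ = P * (S1 - ((riemannZeta 2).re)⁻¹) := by ring
    rw [e, abs_mul, abs_of_nonneg hP0]
    refine hsecond.trans ?_
    calc P * (1 / D) ≤ M ^ (2 * r + 2) / w ^ 2 * (1 / (M / w)) := by gcongr
      _ = M ^ (2 * r + 1) / w * 1 := by
        field_simp
        ring
      _ ≤ _ := mul_le_mul_of_nonneg_left (by linarith) (by positivity)
  calc |S0 - P * ((riemannZeta 2).re)⁻¹| ≤
        |S0 - S1 * P| + |S1 * P - P * ((riemannZeta 2).re)⁻¹| := abs_sub_le _ _ _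
    _ ≤ _ := add_le_add hfirst' hsecond'
    _ = _ := by ring

/-! ### Coordinatewise coprime exponent vectors -/

/-- The pairs `(a, b)` of vectors of positive integers with `a i` and `b i` coprime for every `i`,
`∑ i, a i * w i ≤ s` and `∑ i, b i * w i ≤ t`. For positive weights `w` the box of the encoding
imposes only positivity, see `mem_coprimeExponents`. -/
noncomputable def coprimeExponents {r : ℕ} (w : Fin r → ℝ) (s t : ℝ) :
    Finset ((Fin r → ℕ) × (Fin r → ℕ)) :=
  {q ∈ (Fintype.piFinset fun i => Icc 1 ⌊s / w i⌋₊) ×ˢ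
      (Fintype.piFinset fun i => Icc 1 ⌊t / w i⌋₊) |
    (∀ i, (q.1 i).Coprime (q.2 i)) ∧ ∑ i, q.1 i * w i ≤ s ∧ ∑ i, q.2 i * w i ≤ t}

theorem mem_coprimeExponents {r : ℕ} {w : Fin r → ℝ} (hw : ∀ i, 0 < w i) {s t : ℝ}
    {q : (Fin r → ℕ) × (Fin r → ℕ)} :
    q ∈ coprimeExponents w s t ↔ (∀ i, 1 ≤ q.1 i) ∧ (∀ i, 1 ≤ q.2 i) ∧
      (∀ i, (q.1 i).Coprime (q.2 i)) ∧ ∑ i, q.1 i * w i ≤ s ∧ ∑ i, q.2 i * w i ≤ t := by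
  have key : ∀ (a : Fin r → ℕ) (u : ℝ), ∑ i, a i * w i ≤ u → ∀ i, a i ≤ ⌊u / w i⌋₊ := by
    intro a u h i
    refine Nat.le_floor ((le_div_iff₀ (hw i)).2 (le_trans ?_ h))
    exact single_le_sum (f := fun i => (a i : ℝ) * w i)
      (fun j _ => mul_nonneg (Nat.cast_nonneg _) (hw j).le) (mem_univ i)
  simp only [coprimeExponents, mem_filter, mem_product, Fintype.mem_piFinset, mem_Icc]
  constructor
  · rintro ⟨⟨h1, h2⟩, h3⟩
    exact ⟨fun i => (h1 i).1, fun i => (h2 i).1, h3⟩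
  · rintro ⟨h1, h2, h3, h4, h5⟩
    exact ⟨⟨fun i => ⟨h1 i, key _ _ h4 i⟩, fun i => ⟨h2 i, key _ _ h5 i⟩⟩, h3, h4, h5⟩

theorem card_coprimeExponents_zero (w : Fin 0 → ℝ) {s t : ℝ} (hs : 0 ≤ s) (ht : 0 ≤ t) :
    (coprimeExponents w s t).card = 1 := by
  rw [card_eq_one]
  refine ⟨(Fin.elim0, Fin.elim0), ?_⟩
  ext q
  rw [mem_coprimeExponents (fun i => i.elim0)]
  simp only [mem_singleton, Subsingleton.elim q (Fin.elim0, Fin.elim0)]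
  simp [hs, ht]

/-- Splitting off the first coordinate. -/
theorem card_coprimeExponents_succ {r : ℕ} {w : Fin (r + 1) → ℝ} (hw : ∀ i, 0 < w i) (s t : ℝ) :
    (coprimeExponents w s t).card =
      ∑ a ∈ Icc 1 ⌊s / w 0⌋₊, ∑ b ∈ Icc 1 ⌊t / w 0⌋₊,
        if a.Coprime b then
          (coprimeExponents (fun i => w i.succ) (s - a * w 0) (t - b * w 0)).card
        else 0 := by
  have hw' : ∀ i : Fin r, 0 < w i.succ := fun i => hw _
  have hmaps : ∀ q ∈ coprimeExponents w s t,
      (q.1 0, q.2 0) ∈ Icc 1 ⌊s / w 0⌋₊ ×ˢ Icc 1 ⌊t / w 0⌋₊ := by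
    intro q hq
    simp only [coprimeExponents, mem_filter, mem_product, Fintype.mem_piFinset] at hq
    exact mem_product.2 ⟨hq.1.1 0, hq.1.2 0⟩
  rw [card_eq_sum_card_fiberwise hmaps, sum_product]
  refine sum_congr rfl fun a ha => sum_congr rfl fun b hb => ?_
  rw [mem_Icc] at ha hb
  split_ifs with hab
  · refine card_nbij' (fun q => (fun i => q.1 i.succ, fun i => q.2 i.succ))
      (fun q => (Fin.cons a q.1, Fin.cons b q.2)) ?_ ?_ ?_ ?_
    · intro q hq
      simp only [mem_coe, mem_filter, mem_coprimeExponents hw, Prod.mk.injEq,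
        Fin.sum_univ_succ] at hq
      simp only [mem_coe, mem_coprimeExponents hw']
      obtain ⟨⟨h1, h2, h3, h4, h5⟩, rfl, rfl⟩ := hq
      exact ⟨fun i => h1 _, fun i => h2 _, fun i => h3 _, by linarith, by linarith⟩
    · intro q hq
      simp only [mem_coe, mem_coprimeExponents hw'] at hq
      simp only [mem_coe, mem_filter, mem_coprimeExponents hw, Prod.mk.injEq,
        Fin.sum_univ_succ, Fin.forall_fin_succ, Fin.cons_zero, Fin.cons_succ]
      obtain ⟨h1, h2, h3, h4, h5⟩ := hq
      exact ⟨⟨⟨ha.1, h1⟩, ⟨hb.1, h2⟩, ⟨hab, h3⟩, by linarith, by linarith⟩, trivial, trivial⟩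
    · intro q hq
      simp only [mem_coe, mem_filter, Prod.mk.injEq] at hq
      obtain ⟨-, rfl, rfl⟩ := hq
      exact Prod.ext (Fin.cons_self_tail q.1) (Fin.cons_self_tail q.2)
    · intro q _
      simp
  · rw [card_eq_zero, filter_eq_empty_iff]
    intro q hq h
    rw [mem_coprimeExponents hw] at hq
    rw [Prod.mk.injEq] at h
    exact hab (h.1 ▸ h.2 ▸ hq.2.2.1 0)

/-- Asymptotic count of coordinatewise coprime exponent vectors, uniform in `0 ≤ s, t ≤ M`. The error
is written as `M ^ (2 * r)` times `(1 + log M) / M`, so that the statement is meaningful, with error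
zero, at `r = 0`, and the second factor is unchanged in the induction. -/
theorem abs_card_coprimeExponents_sub_le (r : ℕ) :
    ∀ w : Fin r → ℝ, (∀ i, 0 < w i) → ∃ C : ℝ, 0 ≤ C ∧ ∀ M : ℝ, 1 ≤ M →
      ∀ s t : ℝ, 0 ≤ s → s ≤ M → 0 ≤ t → t ≤ M →
        |((coprimeExponents w s t).card : ℝ) -
          1 / ((r.factorial : ℝ) ^ 2 * (riemannZeta 2).re ^ r) * (∏ i, 1 / w i ^ 2) *
            (s ^ r * t ^ r)| ≤ C * (M ^ (2 * r) * ((1 + Real.log M) / M)) := by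
  induction r with
  | zero =>
    intro w _
    refine ⟨0, le_rfl, fun M _ s t hs _ ht _ => ?_⟩
    rw [card_coprimeExponents_zero w hs ht]
    simp
  | succ r ih =>
    intro w hw
    obtain ⟨C, hC, ih⟩ := ih (fun i => w i.succ) (fun i => hw _)
    obtain ⟨K, hK, hsum⟩ := abs_sum_coprime_pow_sub_le (hw 0) r
    set c := 1 / ((r.factorial : ℝ) ^ 2 * (riemannZeta 2).re ^ r) * (∏ i : Fin r, 1 / w i.succ ^ 2)
      with hc
    refine ⟨C * (1 / w 0 ^ 2) + |c| * K, by positivity, ?_⟩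
    intro M hM s t hs hsM ht htM
    have hM0 : 0 < M := by linarith
    have hlogM : 0 ≤ Real.log M := Real.log_nonneg hM
    have hw0 := hw 0
    set E := M ^ (2 * r) * ((1 + Real.log M) / M) with hE
    have hE0 : 0 ≤ E := by positivity
    have hfl : ∀ u : ℝ, ∀ a ∈ Icc 1 ⌊u / w 0⌋₊, 0 ≤ u - a * w 0 := by
      intro u a ha
      rw [mem_Icc] at ha
      have h : (a : ℝ) ≤ u / w 0 := (Nat.le_floor_iff' (by omega)).1 ha.2
      rw [le_div_iff₀ hw0] at h
      linarith
    have hcard : ∀ u : ℝ, 0 ≤ u → u ≤ M → ((Icc 1 ⌊u / w 0⌋₊).card : ℝ) ≤ M / w 0 := by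
      intro u hu huM
      rw [Nat.card_Icc, Nat.add_sub_cancel]
      exact (Nat.floor_le (by positivity)).trans (by gcongr)
    set T := ∑ a ∈ Icc 1 ⌊s / w 0⌋₊, ∑ b ∈ Icc 1 ⌊t / w 0⌋₊,
          (if a.Coprime b then (s - a * w 0) ^ r * (t - b * w 0) ^ r else 0) with hT
    -- Replacing each inner count by its main term costs `C * E` for each of the at most
    -- `(M / w 0) ^ 2` pairs.
    have h1 : |((coprimeExponents w s t).card : ℝ) - c * T| ≤ C * E * (M / w 0) ^ 2 := by
      rw [card_coprimeExponents_succ hw, hT, mul_sum]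
      push_cast
      rw [← sum_sub_distrib]
      calc _ ≤ ∑ a ∈ Icc 1 ⌊s / w 0⌋₊, ∑ b ∈ Icc 1 ⌊t / w 0⌋₊, C * E := by
            refine (abs_sum_le_sum_abs _ _).trans (sum_le_sum fun a ha => ?_)
            rw [mul_sum, ← sum_sub_distrib]
            refine (abs_sum_le_sum_abs _ _).trans (sum_le_sum fun b hb => ?_)
            split_ifs
            · have ha0 : 0 ≤ a * w 0 := by positivity
              have hb0 : 0 ≤ b * w 0 := by positivity
              exact ih M hM _ _ (hfl s a ha) (by linarith) (hfl t b hb) (by linarith)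
            · simp only [mul_zero, sub_zero, abs_zero]
              positivity
        _ = C * E * (((Icc 1 ⌊s / w 0⌋₊).card : ℝ) * ((Icc 1 ⌊t / w 0⌋₊).card : ℝ)) := by
            simp only [sum_const, nsmul_eq_mul]
            ring
        _ ≤ C * E * ((M / w 0) * (M / w 0)) := by
            have := hcard s hs hsM
            have := hcard t ht htM
            gcongr
        _ = _ := by ring
    have h2 := mul_le_mul_of_nonneg_left (hsum M hM s t hs hsM ht htM) (abs_nonneg c)
    rw [← abs_mul, mul_sub] at h2
    have e : 1 / (((r + 1).factorial : ℝ) ^ 2 * (riemannZeta 2).re ^ (r + 1)) *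
        (∏ i, 1 / w i ^ 2) * (s ^ (r + 1) * t ^ (r + 1)) =
        c * (s ^ (r + 1) * t ^ (r + 1) / ((r + 1) ^ 2 * w 0 ^ 2) * ((riemannZeta 2).re)⁻¹) := by
      rw [hc, Fin.prod_univ_succ, Nat.factorial_succ]
      push_cast
      simp only [div_eq_mul_inv, mul_inv, pow_succ, pow_zero, one_mul]
      ring
    rw [e]
    refine (abs_sub_le _ (c * T) _).trans ((add_le_add h1 h2).trans (le_of_eq ?_))
    have e2 : M ^ (2 * (r + 1)) = M ^ (2 * r) * M * M := by ring
    have e3 : M ^ (2 * r + 1) = M ^ (2 * r) * M := by ring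
    rw [hE, e2, e3]
    field_simp

/-! ### Passage to exponents -/

theorem primeFactors_eq_of_sqfreeKernel_eq {r : ℕ} {p : Fin r → ℕ} (hp : ∀ i, (p i).Prime)
    (hinj : Function.Injective p) {n : ℕ} (h : sqfreeKernel n = ∏ i, p i) :
    n.primeFactors = univ.image p := by
  have h1 : ∏ q ∈ univ.image p, q = ∏ i, p i := prod_image fun i _ j _ hij => hinj hij
  rw [sqfreeKernel, ← h1] at h
  have h2 := congrArg Nat.primeFactors h
  rwa [Nat.primeFactors_prod fun q hq => Nat.prime_of_mem_primeFactors hq,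
    Nat.primeFactors_prod] at h2
  intro q hq
  obtain ⟨i, -, rfl⟩ := mem_image.1 hq
  exact hp i

theorem factorization_prod_prime_pow {r : ℕ} {p : Fin r → ℕ} (hp : ∀ i, (p i).Prime)
    (hinj : Function.Injective p) (a : Fin r → ℕ) (j : Fin r) :
    (∏ i, p i ^ a i).factorization (p j) = a j := by
  rw [Nat.factorization_prod fun i _ => pow_ne_zero _ (hp i).ne_zero, Finsupp.finsetSum_apply]
  rw [sum_eq_single j]
  · simp [(hp j).factorization_pow]
  · intro i _ hij
    rw [(hp i).factorization_pow, Finsupp.single_apply, if_neg fun h => hij (hinj h)]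
  · simp

theorem primeFactors_prod_prime_pow {r : ℕ} {p : Fin r → ℕ} (hp : ∀ i, (p i).Prime)
    {a : Fin r → ℕ} (ha : ∀ i, 1 ≤ a i) :
    (∏ i, p i ^ a i).primeFactors = univ.image p := by
  ext q
  simp only [Nat.mem_primeFactors, mem_image, mem_univ, true_and]
  constructor
  · rintro ⟨hq, hd, -⟩
    obtain ⟨i, -, hi⟩ := (hq.prime.dvd_finsetProd_iff _).1 hd
    exact ⟨i, ((Nat.prime_dvd_prime_iff_eq hq (hp i)).1 (hq.dvd_of_dvd_pow hi)).symm⟩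
  · rintro ⟨i, rfl⟩
    refine ⟨hp i, (dvd_pow_self _ ?_).trans (dvd_prod_of_mem _ (mem_univ i)), ?_⟩
    · have := ha i; omega
    · exact prod_ne_zero_iff.2 fun j _ => pow_ne_zero _ (hp j).ne_zero

theorem prod_prime_pow_le_iff {r : ℕ} {p : Fin r → ℕ} (hp : ∀ i, (p i).Prime)
    (a : Fin r → ℕ) {x : ℝ} (hx : 0 < x) :
    ((∏ i, p i ^ a i : ℕ) : ℝ) ≤ x ↔ ∑ i, a i * Real.log (p i) ≤ Real.log x := by
  have h0 : ∀ i, (0 : ℝ) < p i := fun i => by exact_mod_cast (hp i).pos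
  have hpos : (0 : ℝ) < ∏ i, (p i : ℝ) ^ a i := prod_pos fun i _ => pow_pos (h0 i) _
  push_cast
  rw [← Real.log_le_log_iff hpos hx, Real.log_prod fun i _ => (pow_pos (h0 i) _).ne']
  simp only [Real.log_pow]

/-- Pairs of integers correspond to their pairs of exponent vectors, with weights `log (p i)`. -/
theorem expCoprimeCount_eq_card {r : ℕ} {p : Fin r → ℕ} (hp : ∀ i, (p i).Prime)
    (hinj : Function.Injective p) {x : ℝ} (hx : 0 < x) :
    expCoprimeCount p x =
      (coprimeExponents (fun i => Real.log (p i)) (Real.log x) (Real.log x)).card := by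
  have hw : ∀ i, 0 < Real.log (p i) := fun i =>
    Real.log_pos (by exact_mod_cast (hp i).one_lt)
  have hne : ∀ a : Fin r → ℕ, ∏ i, p i ^ a i ≠ 0 := fun a =>
    prod_ne_zero_iff.2 fun j _ => pow_ne_zero _ (hp j).ne_zero
  have hker : ∀ n : ℕ, n.primeFactors = univ.image p → sqfreeKernel n = ∏ i, p i := by
    intro n hn
    rw [sqfreeKernel, hn, prod_image fun i _ j _ hij => hinj hij]
  rw [expCoprimeCount, ← Set.ncard_coe_finset]
  symm
  refine Set.ncard_congr (fun q _ => (∏ i, p i ^ q.1 i, ∏ i, p i ^ q.2 i)) ?_ ?_ ?_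
  · intro q hq
    rw [mem_coe, mem_coprimeExponents hw] at hq
    obtain ⟨h1, h2, h3, h4, h5⟩ := hq
    have e1 := primeFactors_prod_prime_pow hp h1
    have e2 := primeFactors_prod_prime_pow hp h2
    refine ⟨⟨hne _, hne _, e1.trans e2.symm, ?_⟩, hker _ e1, hker _ e2,
      (prod_prime_pow_le_iff hp _ hx).2 h4, (prod_prime_pow_le_iff hp _ hx).2 h5⟩
    intro l hl
    rw [e1] at hl
    obtain ⟨i, -, rfl⟩ := mem_image.1 hl
    rw [factorization_prod_prime_pow hp hinj, factorization_prod_prime_pow hp hinj]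
    exact h3 i
  · intro q q' _ _ h
    rw [Prod.mk.injEq] at h
    ext i
    · rw [← factorization_prod_prime_pow hp hinj q.1, h.1, factorization_prod_prime_pow hp hinj]
    · rw [← factorization_prod_prime_pow hp hinj q.2, h.2, factorization_prod_prime_pow hp hinj]
  · rintro ⟨n, m⟩ ⟨⟨hn, hm, -, hcop⟩, h1, h2, h3, h4⟩
    have e1 := primeFactors_eq_of_sqfreeKernel_eq hp hinj h1
    have e2 := primeFactors_eq_of_sqfreeKernel_eq hp hinj h2
    have hprod : ∀ k : ℕ, k ≠ 0 → k.primeFactors = univ.image p →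
        ∏ i, p i ^ k.factorization (p i) = k := by
      intro k hk hkp
      conv_rhs => rw [← Nat.prod_factorization_pow_eq_self hk]
      rw [Finsupp.prod, Nat.support_factorization, hkp, prod_image fun i _ j _ hij => hinj hij]
    have hone : ∀ k : ℕ, k ≠ 0 → k.primeFactors = univ.image p →
        ∀ i, 1 ≤ k.factorization (p i) := by
      intro k hk hkp i
      have : p i ∈ k.primeFactors := hkp ▸ mem_image_of_mem p (mem_univ i)
      exact (hp i).factorization_pos_of_dvd hk (Nat.dvd_of_mem_primeFactors this)
    refine ⟨(fun i => n.factorization (p i), fun i => m.factorization (p i)), ?_, ?_⟩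
    · rw [mem_coe, mem_coprimeExponents hw]
      refine ⟨hone n hn e1, hone m hm e2, fun i => hcop _ ?_, ?_, ?_⟩
      · exact e1 ▸ mem_image_of_mem p (mem_univ i)
      · rw [← prod_prime_pow_le_iff hp _ hx, hprod n hn e1]; exact h3
      · rw [← prod_prime_pow_le_iff hp _ hx, hprod m hm e2]; exact h4
    · exact Prod.ext (hprod n hn e1) (hprod m hm e2)

theorem theorem2 (r : ℕ) (hr : 1 ≤ r) (p : Fin r → ℕ) (hp : ∀ i, (p i).Prime)
    (hinj : Function.Injective p) :
    ∃ C : ℝ, ∀ x : ℝ, 3 ≤ x →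
      |(expCoprimeCount p x : ℝ) -
          1 / ((r.factorial : ℝ) ^ 2 * (riemannZeta 2).re ^ r) *
            (∏ i, 1 / Real.log (p i) ^ 2) * Real.log x ^ (2 * r)| ≤
        C * (Real.log x ^ (2 * r - 1) * Real.log (Real.log x)) := by
  obtain ⟨C, hC, h⟩ := abs_card_coprimeExponents_sub_le r (fun i => Real.log (p i)) fun i =>
    Real.log_pos (by exact_mod_cast (hp i).one_lt)
  -- On `x ≥ 3` the quantity `log (log x)` is bounded below by `log (log 3) > 0`, so that it
  -- dominates `1 + log (log x)` up to a constant factor.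
  have h3 : 1 < Real.log 3 :=
    (Real.lt_log_iff_exp_lt (by norm_num)).2 (Real.exp_one_lt_d9.trans (by norm_num))
  have hll3 : 0 < Real.log (Real.log 3) := Real.log_pos h3
  refine ⟨C * (1 / Real.log (Real.log 3) + 1), fun x hx => ?_⟩
  have hL3 : Real.log 3 ≤ Real.log x := Real.log_le_log (by norm_num) hx
  have hL : 1 ≤ Real.log x := h3.le.trans hL3
  have hL0 : 0 < Real.log x := by linarith
  have hLL : Real.log (Real.log 3) ≤ Real.log (Real.log x) :=
    Real.log_le_log (by linarith) hL3
  have hmain := h _ hL _ _ hL0.le le_rfl hL0.le le_rfl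
  rw [expCoprimeCount_eq_card hp hinj (by linarith)]
  have e : Real.log x ^ (2 * r) = Real.log x ^ r * Real.log x ^ r := by ring
  have e' : Real.log x ^ (2 * r) = Real.log x ^ (2 * r - 1) * Real.log x := by
    rw [← pow_succ]
    congr 1
    omega
  rw [← e] at hmain
  refine hmain.trans ?_
  rw [mul_assoc]
  refine mul_le_mul_of_nonneg_left ?_ hC
  calc Real.log x ^ (2 * r) * ((1 + Real.log (Real.log x)) / Real.log x)
      = Real.log x ^ (2 * r - 1) * (1 + Real.log (Real.log x)) := by
        rw [e']
        field_simp
    _ ≤ Real.log x ^ (2 * r - 1) *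
          ((1 / Real.log (Real.log 3) + 1) * Real.log (Real.log x)) := by
        refine mul_le_mul_of_nonneg_left ?_ (by positivity)
        have : 1 ≤ 1 / Real.log (Real.log 3) * Real.log (Real.log x) := by
          rw [one_div_mul_eq_div]
          exact (one_le_div hll3).2 hLL
        linarith
    _ = _ := by ring
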